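/- Let $L$ be a first-order language containing a binary function symbol $+$, and let $G$ be an infinite abelian group, considered as an $L$-structure $(G,+,\dots)$ that expands its group structure. Let $\kappa$ be an infinite cardinal, let $G^*$ be a $\kappa$-saturated elementary extension of $(G,+,\dots)$, and let $A\subseteq G^*$ be a small set of parameters, that is, $|A|<\kappa$. A subgroup of $G^*$ is type-definable over $A$ if it is an intersection of $A$-definable subsets of $G^*$, and it has bounded index if its index in $G^*$ is less than $\kappa$. The type-connected component $G_A^{*00}$ is the smallest subgroup of $G^*$ that is type-definable over $A$ and of bounded index. The component $G_A^{*00}$ exists if $\kappa$ is sufficiently big, namely if $2^{\aleph_0+|L|+|A|}<\kappa$, where $|L|$ is the number of symbols of $L$. Moreover, whenever $G_A^{*00}$ exists, the group $G_A^{*00}$ is divisible (that is, $n\cdot G_A^{*00}=G_A^{*00}$ for every integer $n\ge 1$) if and only if for every integer $n\ge 1$ the subgroup $nG=\{ng : g\in G\}$ has finite index in $G$. -/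

import Mathlib

open Cardinal FirstOrder

universe u v w w'

/-- The binary function symbol `f` of `L` is interpreted in the `L`-structure `M` as the addition
of `M`; that is, `M` is an expansion of the group `(M, +)`. -/
def InterpretsAdd {L : FirstOrder.Language.{u, v}} (f : L.Functions 2) (M : Type w) [L.Structure M]
    [Add M] : Prop :=
  ∀ x y : M, FirstOrder.Language.Structure.funMap f ![x, y] = x + y

/-- `M` is `κ`-saturated: every set of formulas in one free variable, with parameters from a set
of cardinality less than `κ`, that is finitely satisfiable in `M` is realized in `M`. -/
def IsSaturatedModel (L : FirstOrder.Language.{u, v}) (κ : Cardinal.{w}) (M : Type w) [L.Structure M] :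
    Prop :=
  ∀ B : Set M, #B < κ → ∀ p : Set (L[[B]].Formula (Fin 1)),
    (∀ q : Finset (L[[B]].Formula (Fin 1)), (q : Set (L[[B]].Formula (Fin 1))) ⊆ p →
      ∃ x : M, ∀ φ ∈ q, φ.Realize (fun _ => x)) →
    ∃ x : M, ∀ φ ∈ p, φ.Realize (fun _ => x)

/-- A subset of `M` is type-definable over `A` if it is an intersection of `A`-definable sets. -/
def IsTypeDefinable (L : FirstOrder.Language.{u, v}) {M : Type w} [L.Structure M] (A : Set M) (s : Set M) :
    Prop :=
  ∃ F : Set (Set M), (∀ P ∈ F, A.Definable₁ L P) ∧ s = ⋂₀ F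

/-- `H` is the type-connected component of `M` over `A`: the smallest subgroup among those that
are type-definable over `A` and have bounded index (that is, index less than `κ`). -/
def IsTypeConnectedComponent (L : FirstOrder.Language.{u, v}) (κ : Cardinal.{w}) {M : Type w}
    [L.Structure M] [AddCommGroup M] (A : Set M) (H : AddSubgroup M) : Prop :=
  IsLeast {K : AddSubgroup M | IsTypeDefinable L A (K : Set M) ∧ #(M ⧸ K) < κ} H

/-- An abelian group is divisible if multiplication by every positive integer is onto. -/
def IsDivisibleGroup (M : Type w) [AddCommGroup M] : Prop :=
  ∀ n : ℕ, 0 < n → ∀ x : M, ∃ y : M, n • y = x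

/-! Everything is compactness. By saturation, an `A`-definable `X` containing a type-definable
subgroup of bounded index contains `Y - Y` for another such definable `Y`, and finitely many
translates of `Y` cover the group (`exists_finite_cover`). So countably many colours suffice for
equal colours to force a difference in `X`. With μ = ℵ₀ + |L| + |A|, there are at most μ such `X`,
and recording all colours bounds the index of the intersection of all these subgroups by 2^μ.

If `H` is the component and `nG` has finite index, then `nH` is again type-definable of bounded
index, so minimality gives `H ≤ nH`. Conversely, divisible `H` lies in the definable group of `n`-th
multiples, which is then covered by finitely many translates. Finiteness of that index passes
between `G` and its extension because it is first-order. -/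

open FirstOrder.Language Set

/-! ### Multiples as terms -/

section Terms

variable {L : FirstOrder.Language.{u, v}} {M : Type w} [L.Structure M] [AddCommGroup M]

/-- The term `(n + 1) • t`, written with the binary function symbol `f` as addition. -/
def succNSMulTerm (f : L.Functions 2) {α : Type*} (t : L.Term α) : ℕ → L.Term α
  -- Multiples start at one, since `L` need not have a symbol for zero.
  | 0 => t
  | n + 1 => f.apply₂ (succNSMulTerm f t n) t

theorem realize_succNSMulTerm {f : L.Functions 2} (hf : InterpretsAdd f M) {α : Type*}
    (t : L.Term α) (n : ℕ) (v : α → M) :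
    (succNSMulTerm f t n).realize v = (n + 1) • t.realize v := by
  induction n with
  | zero => simp [succNSMulTerm]
  | succ n ih =>
    rw [succNSMulTerm, Term.realize_functions_apply₂, hf, ih, succ_nsmul _ (n + 1)]

end Terms

/-! ### Definable relations and counting definable sets -/

section Definability

variable {L : FirstOrder.Language.{u, v}} {M : Type w} [L.Structure M] {A B : Set M}

theorem definable_of_formula {α : Type*} (φ : L.Formula α) :
    A.Definable L {v : α → M | φ.Realize v} :=
  Definable.mono (empty_definable_iff.2 ⟨φ, rfl⟩) (empty_subset A)

theorem definable_exists {α : Type*} {P : (α → M) → M → Prop}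
    (h : A.Definable L {v : α ⊕ Unit → M | P (v ∘ Sum.inl) (v (Sum.inr ()))}) :
    A.Definable L {v : α → M | ∃ z, P v z} := by
  convert! h.exists_of_finite using 1
  ext v
  simp only [mem_ofPred_eq, Sum.elim_comp_inl, Sum.elim_inr]
  exact ⟨fun ⟨z, hz⟩ => ⟨fun _ => z, hz⟩, fun ⟨z, hz⟩ => ⟨z (), hz⟩⟩

theorem definable_mem {X : Set M} (hX : A.Definable₁ L X) {α : Type*} (i : α) :
    A.Definable L {v : α → M | v i ∈ X} :=
  Definable.preimage_comp (fun _ : Fin 1 => i) hX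

/-- A binary relation on `M` is definable over `A`. -/
def DefinableRel (L : FirstOrder.Language.{u, v}) [L.Structure M] (A : Set M)
    (P : M → M → Prop) : Prop :=
  A.Definable L {v : Fin 2 → M | P (v 0) (v 1)}

namespace DefinableRel

variable {P Q : M → M → Prop}

theorem comp (h : DefinableRel L A P) {α : Type*} (i k : α) :
    A.Definable L {v : α → M | P (v i) (v k)} := by
  have := Definable.preimage_comp ![i, k] h
  simpa using this

theorem mono (h : DefinableRel L A P) (hAB : A ⊆ B) : DefinableRel L B P :=
  Definable.mono h hAB

theorem swap (h : DefinableRel L A P) : DefinableRel L A (fun x y => P y x) :=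
  h.comp 1 0

theorem and (hP : DefinableRel L A P) (hQ : DefinableRel L A Q) :
    DefinableRel L A (fun x y => P x y ∧ Q x y) :=
  Definable.inter hP hQ

theorem not (hP : DefinableRel L A P) : DefinableRel L A (fun x y => ¬ P x y) :=
  Definable.compl hP

theorem fst {X : Set M} (hX : A.Definable₁ L X) : DefinableRel L A (fun x _ => x ∈ X) :=
  definable_mem hX 0

theorem exists_right (h : DefinableRel L A P) : A.Definable₁ L {x | ∃ y, P x y} :=
  definable_exists (P := fun v y => P (v 0) y) (h.comp (Sum.inl 0) (Sum.inr ()))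

theorem fix_right (h : DefinableRel L A P) {c : M} (hc : c ∈ A) :
    A.Definable₁ L {x | P x c} := by
  -- The parameter is substituted by quantifying over the definable singleton `{c}`.
  have := (h.and (fst (Definable.singleton_of_mem L hc)).swap).exists_right
  simpa using this

variable [AddCommGroup M] {f : L.Functions 2} (hf : InterpretsAdd f M)
include hf

theorem sub_mem {X : Set M} (hX : A.Definable₁ L X) :
    DefinableRel L A (fun x y => x - y ∈ X) := by
  have h : A.Definable L {v : Fin 2 → M | ∃ z, z ∈ X ∧ z + v 1 = v 0} := by
    refine definable_exists (P := fun v z => z ∈ X ∧ z + v 1 = v 0) ?_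
    refine (definable_mem hX (Sum.inr ())).inter ?_
    have := definable_of_formula (M := M) (A := A)
      ((f.apply₂ (Term.var (Sum.inr ())) (Term.var (Sum.inl 1))).equal
        (Term.var (Sum.inl 0)) : L.Formula (Fin 2 ⊕ Unit))
    simp only [Formula.realize_equal, Term.realize_functions_apply₂, hf _ _,
      Term.realize_var] at this
    exact this
  simpa [DefinableRel, ← eq_sub_iff_add_eq] using h

theorem nsmul_eq {n : ℕ} (hn : 0 < n) : DefinableRel L A (fun x y : M => n • x = y) := by
  obtain ⟨n, rfl⟩ := Nat.exists_eq_succ_of_ne_zero hn.ne'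
  have := definable_of_formula (M := M) (A := A)
    ((succNSMulTerm f (Term.var 0) n).equal (Term.var 1) : L.Formula (Fin 2))
  simp only [Formula.realize_equal, realize_succNSMulTerm hf, Term.realize_var] at this
  exact this

end DefinableRel

/-- Distinct sets need distinct defining formulas, so counting `L[[A]]`-formulas suffices. -/
theorem lift_mk_definable₁_le (F : Set (Set M)) (hF : ∀ X ∈ F, A.Definable₁ L X) :
    Cardinal.lift.{max u v} #F ≤
      ℵ₀ + Cardinal.lift.{w} L.card + Cardinal.lift.{max u v} #A := by
  choose φ hφ using fun X : F => hF X X.2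
  have hinj : Function.Injective φ := by
    intro X Y h
    have h' := hφ X
    rw [h, ← hφ Y] at h'
    refine Subtype.ext (Set.ext fun x => ?_)
    exact Set.ext_iff.1 h' (fun _ => x)
  have h1 := Cardinal.mk_le_of_injective (α := ULift.{max u v} F)
    (f := fun X => (⟨0, φ X.down⟩ : Σ n, L[[A]].BoundedFormula (Fin 1) n)) (by
      intro X Y h
      simp only [Sigma.mk.injEq, heq_eq_eq, true_and] at h
      exact ULift.down_injective (hinj h))
  rw [Cardinal.mk_uLift] at h1
  refine h1.trans (BoundedFormula.card_le.trans ?_)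
  rw [card_withConstants]
  refine max_le ?_ ?_
  · rw [add_assoc]; exact self_le_add_right _ _
  · simp only [Cardinal.mk_fin, Nat.cast_one, Cardinal.lift_one,
      Cardinal.lift_id', Cardinal.lift_umax]
    rw [← add_assoc]
    gcongr
    exact Cardinal.one_le_aleph0

end Definability

/-! ### Compactness, the component and divisibility -/

section Saturation

variable {L : FirstOrder.Language.{u, v}} {M : Type w} [L.Structure M] {κ : Cardinal.{w}}
  {A : Set M}

theorem IsSaturatedModel.sInter_nonempty (hsat : IsSaturatedModel L κ M) (hA : #A < κ)
    (F : Set (Set M)) (hF : ∀ X ∈ F, A.Definable₁ L X)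
    (hfin : ∀ T : Set (Set M), T.Finite → T ⊆ F → (⋂₀ T).Nonempty) : (⋂₀ F).Nonempty := by
  obtain ⟨x, hx⟩ := hsat A hA {φ | {x | φ.Realize (fun _ => x)} ∈ F} (by
    intro q hq
    obtain ⟨x, hx⟩ := hfin ((fun φ : L[[A]].Formula (Fin 1) => {x | φ.Realize (fun _ => x)}) '' q)
      (q.finite_toSet.image _) (by rintro _ ⟨φ, hφ, rfl⟩; exact hq hφ)
    exact ⟨x, fun φ hφ => hx _ ⟨φ, hφ, rfl⟩⟩)
  refine ⟨x, fun X hX => ?_⟩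
  obtain ⟨φ, hφ⟩ := hF X hX
  have h : {x | φ.Realize (fun _ => x)} = X :=
    Set.ext fun y => (Set.ext_iff.1 hφ (fun _ => y)).symm
  have := hx φ (by rw [mem_ofPred_eq, h]; exact hX)
  exact h ▸ this

theorem IsSaturatedModel.sInter_nonempty_of_directed (hsat : IsSaturatedModel L κ M) (hA : #A < κ)
    {ι : Type*} [Nonempty ι] (F : ι → Set M) (hdef : ∀ i, A.Definable₁ L (F i))
    (hdir : Directed (· ⊇ ·) F) (hne : ∀ i, (F i).Nonempty) : (⋂ i, F i).Nonempty := by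
  rw [← sInter_range]
  refine hsat.sInter_nonempty hA _ (forall_mem_range.2 hdef) fun T hT hTF => ?_
  obtain ⟨i, hi⟩ : ∃ i, F i ⊆ ⋂₀ T := by
    induction T, hT using Set.Finite.induction_on with
    | empty => exact ⟨Classical.arbitrary ι, by simp⟩
    | @insert X T _ _ ih =>
      obtain ⟨⟨k, rfl⟩, hT⟩ := insert_subset_iff.1 hTF
      obtain ⟨i, hi⟩ := ih hT
      obtain ⟨l, h1, h2⟩ := hdir k i
      exact ⟨l, by rw [sInter_insert]; exact subset_inter h1 (h2.trans hi)⟩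
  exact (hne i).mono hi

/-- The `A`-definable sets that contain `s`. -/
def DefinableSuperset (L : FirstOrder.Language.{u, v}) [L.Structure M] (A s : Set M) : Type w :=
  {X : Set M // A.Definable₁ L X ∧ s ⊆ X}

namespace DefinableSuperset

variable {s : Set M}

instance : Nonempty (DefinableSuperset L A s) := ⟨⟨univ, definable_univ, subset_univ s⟩⟩

theorem exists_le (X Y : DefinableSuperset L A s) :
    ∃ Z : DefinableSuperset L A s, Z.1 ⊆ X.1 ∧ Z.1 ⊆ Y.1 :=
  ⟨⟨X.1 ∩ Y.1, Definable.inter X.2.1 Y.2.1, subset_inter X.2.2 Y.2.2⟩,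
    inter_subset_left, inter_subset_right⟩

end DefinableSuperset

theorem IsTypeDefinable.mem_iff {s : Set M} (hs : IsTypeDefinable L A s) {x : M} :
    x ∈ s ↔ ∀ X : DefinableSuperset L A s, x ∈ X.1 := by
  refine ⟨fun h X => X.2.2 h, fun h => ?_⟩
  obtain ⟨F, hF, rfl⟩ := hs
  exact fun X hX => h ⟨X, hF X hX, sInter_subset_of_mem hX⟩

theorem mk_union_lt {B : Set M} (hκ : ℵ₀ ≤ κ) (hA : #A < κ) (hB : #B < κ) :
    #(A ∪ B : Set M) < κ :=
  (Cardinal.mk_union_le A B).trans_lt (Cardinal.add_lt_of_lt hκ hA hB)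

theorem mk_insert_lt (hκ : ℵ₀ ≤ κ) (hA : #A < κ) (x : M) : #(insert x A : Set M) < κ :=
  Cardinal.mk_insert_le.trans_lt
    (Cardinal.add_lt_of_lt hκ hA (Cardinal.one_lt_aleph0.trans_le hκ))

variable [AddCommGroup M] {f : L.Functions 2} (hf : InterpretsAdd f M)
  (hsat : IsSaturatedModel L κ M) (hκ : ℵ₀ ≤ κ) (hA : #A < κ)
include hf hsat hκ hA

/-- A definable set that contains a subgroup of bounded index is generic: finitely many of its
translates cover the group. -/
theorem exists_finite_cover {K : AddSubgroup M} (hK : #(M ⧸ K) < κ) {X : Set M}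
    (hX : A.Definable₁ L X) (hKX : (K : Set M) ⊆ X) :
    ∃ T : Set M, T.Finite ∧ ∀ x, ∃ t ∈ T, x - t ∈ X := by
  let R : Set M := range (Quotient.out : M ⧸ K → M)
  have hB : #(A ∪ R : Set M) < κ := mk_union_lt hκ hA (Cardinal.mk_range_le.trans_lt hK)
  -- Saturation over `A` and the small set `R` of coset representatives would give an `x` outside
  -- every `r + X`, yet `x` lies in `r + K` for its own representative `r`.
  by_contra! hcon
  have := hsat.sInter_nonempty hB ((fun r => {x | x - r ∉ X}) '' R) (by
    rintro _ ⟨r, hr, rfl⟩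
    exact ((DefinableRel.sub_mem hf (hX.mono subset_union_left)).not).fix_right (Or.inr hr)) (by
    intro T hT hTR
    obtain ⟨S, hSR, hS, rfl⟩ := exists_subset_image_finite_and (p := fun t => t = T).1
      ⟨T, hTR, hT, rfl⟩
    obtain ⟨x, hx⟩ := hcon S hS
    exact ⟨x, by rintro _ ⟨r, hr, rfl⟩; exact hx r hr⟩)
  obtain ⟨x, hx⟩ := this
  refine hx _ ⟨_, ⟨(x : M ⧸ K), rfl⟩, rfl⟩ (hKX ?_)
  have := QuotientAddGroup.eq (s := K).1 (QuotientAddGroup.out_eq' (x : M ⧸ K))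
  simpa [sub_eq_neg_add] using this

/-- Otherwise compactness yields `a`, `b` in `K` with `a - b` outside `X`. Saturation handles one
variable only, so `a` is found first and becomes a parameter for `b`. -/
theorem exists_definableSuperset_sub_mem {K : AddSubgroup M} (hK : IsTypeDefinable L A (K : Set M))
    (X : DefinableSuperset L A (K : Set M)) :
    ∃ Y : DefinableSuperset L A (K : Set M), ∀ a ∈ Y.1, ∀ b ∈ Y.1, a - b ∈ X.1 := by
  by_contra! hcon
  obtain ⟨a, ha⟩ := hsat.sInter_nonempty_of_directed hA
    (fun Y : DefinableSuperset L A (K : Set M) => {a | ∃ b, a ∈ Y.1 ∧ b ∈ Y.1 ∧ a - b ∉ X.1})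
    (fun Y => ((DefinableRel.fst Y.2.1).and
      ((DefinableRel.fst Y.2.1).swap.and (DefinableRel.sub_mem hf X.2.1).not)).exists_right)
    (fun Y Z => by
      obtain ⟨W, hY, hZ⟩ := Y.exists_le Z
      exact ⟨W, fun a ⟨b, h1, h2, h3⟩ => ⟨b, hY h1, hY h2, h3⟩,
        fun a ⟨b, h1, h2, h3⟩ => ⟨b, hZ h1, hZ h2, h3⟩⟩)
    (fun Y => let ⟨a, ha, b, hb, h⟩ := hcon Y; ⟨a, b, ha, hb, h⟩)
  rw [mem_iInter] at ha
  have hAa : A ⊆ insert a A := subset_insert a A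
  obtain ⟨b, hb⟩ := hsat.sInter_nonempty_of_directed (mk_insert_lt hκ hA a)
    (fun Y : DefinableSuperset L A (K : Set M) => {b | b ∈ Y.1 ∧ a - b ∉ X.1})
    (fun Y => ((DefinableRel.fst Y.2.1).and
      (DefinableRel.sub_mem hf X.2.1).not.swap |>.mono hAa).fix_right (mem_insert a A))
    (fun Y Z => by
      obtain ⟨W, hY, hZ⟩ := Y.exists_le Z
      exact ⟨W, fun b ⟨h1, h2⟩ => ⟨hY h1, h2⟩, fun b ⟨h1, h2⟩ => ⟨hZ h1, h2⟩⟩)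
    (fun Y => let ⟨b, _, hb, h⟩ := ha Y; ⟨b, hb, h⟩)
  rw [mem_iInter] at hb
  have haK : a ∈ K := hK.mem_iff.2 fun Y => (ha Y).choose_spec.1
  have hbK : b ∈ K := hK.mem_iff.2 fun Y => (hb Y).1
  exact (hb X).2 (X.2.2 (K.sub_mem haK hbK))

theorem exists_coloring {K : AddSubgroup M} (hK : IsTypeDefinable L A (K : Set M))
    (hKκ : #(M ⧸ K) < κ) (X : DefinableSuperset L A (K : Set M)) :
    ∃ c : M → ℕ, ∀ x y, c x = c y → x - y ∈ X.1 := by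
  obtain ⟨Y, hY⟩ := exists_definableSuperset_sub_mem hf hsat hκ hA hK X
  obtain ⟨T, hT, hcov⟩ := exists_finite_cover hf hsat hκ hA hKκ Y.2.1 Y.2.2
  choose t htT ht using hcov
  obtain ⟨e, he⟩ := countable_iff_exists_injOn.1 hT.countable
  refine ⟨e ∘ t, fun x y hxy => ?_⟩
  have h : t x = t y := he (htT x) (htT y) hxy
  simpa [h] using hY _ (ht x) _ (ht y)

theorem exists_isTypeConnectedComponent
    (h2 : (2 : Cardinal.{max u v w}) ^
        (ℵ₀ + Cardinal.lift.{w} L.card + Cardinal.lift.{max u v} #A) <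
          Cardinal.lift.{max u v} κ) :
    ∃ H : AddSubgroup M, IsTypeConnectedComponent L κ A H := by
  let S : Set (AddSubgroup M) := {K | IsTypeDefinable L A (K : Set M) ∧ #(M ⧸ K) < κ}
  let F : Set (Set M) := {X | A.Definable₁ L X ∧ ∃ K ∈ S, (K : Set M) ⊆ X}
  have hmem : ∀ x, x ∈ sInf S ↔ ∀ X ∈ F, x ∈ X := by
    intro x
    rw [AddSubgroup.mem_sInf]
    refine ⟨fun h X ⟨_, K, hK, hKX⟩ => hKX (h K hK), fun h K hK => ?_⟩
    exact hK.1.mem_iff.2 fun X => h X.1 ⟨X.2.1, K, hK, X.2.2⟩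
  refine ⟨sInf S, ⟨⟨F, fun X hX => hX.1, Set.ext fun x => hmem x⟩, ?_⟩, fun K hK => sInf_le hK⟩
  have hcol : ∀ X : F, ∃ c : M → ℕ, ∀ x y, c x = c y → x - y ∈ X.1 := by
    rintro ⟨X, hX, K, hK, hKX⟩
    exact exists_coloring hf hsat hκ hA hK.1 hK.2 ⟨X, hX, hKX⟩
  choose c hc using hcol
  have hle : #(M ⧸ sInf S) ≤ #(F → ULift.{w} ℕ) := by
    refine Cardinal.mk_le_of_injective (f := fun q X => ⟨c X q.out⟩) fun p q hpq => ?_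
    rw [← QuotientAddGroup.out_eq' p, ← QuotientAddGroup.out_eq' q, eq_comm, QuotientAddGroup.eq,
      ← sub_eq_neg_add, hmem]
    exact fun X hX => hc ⟨X, hX⟩ _ _ (congrArg ULift.down (congrFun hpq ⟨X, hX⟩))
  rw [← Cardinal.lift_lt.{w, max u v}]
  refine (Cardinal.lift_le.2 hle).trans_lt (lt_of_le_of_lt ?_ h2)
  have hF := lift_mk_definable₁_le F fun X hX => hX.1
  have hinf : ℵ₀ ≤ ℵ₀ + Cardinal.lift.{w} L.card + Cardinal.lift.{max u v} #A := by
    rw [add_assoc]; exact self_le_add_right _ _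
  -- Writing 2^μ as μ^μ makes the bound ℵ₀^|F| ≤ μ^μ monotone in base and exponent.
  rw [← Cardinal.power_self_eq hinf]
  simp only [Cardinal.mk_pi, Cardinal.prod_const, Cardinal.lift_power, Cardinal.lift_id,
    Cardinal.mk_uLift, Cardinal.mk_nat, Cardinal.lift_aleph0]
  exact (Cardinal.power_le_power_right hinf).trans
    (Cardinal.power_le_power_left (Cardinal.aleph0_pos.trans_le hinf).ne' hF)

/-- By compactness over `A` and `y`, the image of the intersection is the intersection of the
images. -/
theorem isTypeDefinable_map_nsmul {H : AddSubgroup M} (hH : IsTypeDefinable L A (H : Set M))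
    {n : ℕ} (hn : 0 < n) :
    IsTypeDefinable L A (H.map (nsmulAddMonoidHom n) : Set M) := by
  refine ⟨range fun X : DefinableSuperset L A (H : Set M) => {y | ∃ x, x ∈ X.1 ∧ n • x = y},
    ?_, ?_⟩
  · rintro _ ⟨X, rfl⟩
    exact ((DefinableRel.fst X.2.1).and (DefinableRel.nsmul_eq hf hn)).swap.exists_right
  ext y
  simp only [sInter_range, mem_iInter, AddSubgroup.coe_map, mem_image, mem_ofPred_eq,
    nsmulAddMonoidHom_apply, SetLike.mem_coe]
  refine ⟨fun ⟨x, hx, h⟩ X => ⟨x, X.2.2 hx, h⟩, fun h => ?_⟩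
  obtain ⟨x, hx⟩ := hsat.sInter_nonempty_of_directed (mk_insert_lt hκ hA y)
    (fun X : DefinableSuperset L A (H : Set M) => {x | x ∈ X.1 ∧ n • x = y})
    (fun X => ((DefinableRel.fst X.2.1).and (DefinableRel.nsmul_eq hf hn) |>.mono
      (subset_insert y A)).fix_right (mem_insert y A))
    (fun X Y => by
      obtain ⟨W, hX, hY⟩ := X.exists_le Y
      exact ⟨W, fun b ⟨h1, h2⟩ => ⟨hX h1, h2⟩, fun b ⟨h1, h2⟩ => ⟨hY h1, h2⟩⟩)
    h
  rw [mem_iInter] at hx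
  exact ⟨x, hH.mem_iff.2 fun X => (hx X).1, (hx (Classical.arbitrary _)).2⟩

theorem finiteIndex_range_nsmul_of_isDivisibleGroup {H : AddSubgroup M} (hH : #(M ⧸ H) < κ)
    (hdiv : IsDivisibleGroup H) {n : ℕ} (hn : 0 < n) :
    (nsmulAddMonoidHom n : M →+ M).range.FiniteIndex := by
  have hdef : A.Definable₁ L ((nsmulAddMonoidHom n : M →+ M).range : Set M) :=
    (DefinableRel.nsmul_eq hf hn).swap.exists_right
  obtain ⟨T, hT, hcov⟩ := exists_finite_cover hf hsat hκ hA hH hdef (by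
    intro x hx
    obtain ⟨y, hy⟩ := hdiv n hn ⟨x, hx⟩
    exact ⟨y, congrArg Subtype.val hy⟩)
  have : Finite T := hT
  have : Finite (M ⧸ (nsmulAddMonoidHom n : M →+ M).range) := by
    refine Finite.of_surjective (fun t : T => (t.1 : M ⧸ _)) fun q => ?_
    obtain ⟨x, rfl⟩ := QuotientAddGroup.mk_surjective q
    obtain ⟨t, ht, hx⟩ := hcov x
    exact ⟨⟨t, ht⟩, QuotientAddGroup.eq.2 (by simpa [sub_eq_neg_add] using hx)⟩
  exact AddSubgroup.finiteIndex_of_finite_quotient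

theorem isDivisibleGroup_of_finiteIndex {H : AddSubgroup M}
    (hH : IsTypeConnectedComponent L κ A H)
    (hfin : ∀ n : ℕ, 0 < n → (nsmulAddMonoidHom n : M →+ M).range.FiniteIndex) :
    IsDivisibleGroup H := by
  intro n hn x
  let N : AddSubgroup M := (nsmulAddMonoidHom n : M →+ M).range
  have : N.FiniteIndex := hfin n hn
  let K := H.map (nsmulAddMonoidHom n : M →+ M)
  have hK : #(M ⧸ K) < κ := by
    -- Write `x = r + n • z` with `r` representing `x` modulo `N`, and `z = s + h` with `h ∈ H`;
    -- then `x` lies in `r + n • s + K`.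
    have hle : #(M ⧸ K) ≤ #((M ⧸ N) × (M ⧸ H)) := by
      refine Cardinal.mk_le_of_surjective
        (f := fun p => ((p.1.out + n • p.2.out : M) : M ⧸ K)) fun q => ?_
      obtain ⟨x, rfl⟩ := QuotientAddGroup.mk_surjective q
      have hx : -(x : M ⧸ N).out + x ∈ N :=
        QuotientAddGroup.eq.1 (QuotientAddGroup.out_eq' (x : M ⧸ N))
      obtain ⟨z, hz⟩ := hx
      have hzH : -(z : M ⧸ H).out + z ∈ H :=
        QuotientAddGroup.eq.1 (QuotientAddGroup.out_eq' (z : M ⧸ H))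
      refine ⟨(x, z), QuotientAddGroup.eq.2 ⟨_, hzH, ?_⟩⟩
      simp only [nsmulAddMonoidHom_apply] at hz ⊢
      rw [nsmul_add, hz, neg_nsmul]
      abel
    refine hle.trans_lt ?_
    rw [Cardinal.mk_prod, Cardinal.lift_id, Cardinal.lift_id]
    exact Cardinal.mul_lt_of_lt hκ ((Cardinal.lt_aleph0_of_finite _).trans_le hκ) hH.1.2
  obtain ⟨y, hy, hyx⟩ := hH.2 ⟨isTypeDefinable_map_nsmul hf hsat hκ hA hH.1.1 hn, hK⟩ x.2
  exact ⟨⟨y, hy⟩, Subtype.ext hyx⟩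

end Saturation

/-! ### Transfer along the elementary embedding -/

section Elementary

variable {L : FirstOrder.Language.{u, v}} {f : L.Functions 2}
  {G : Type w'} [AddCommGroup G] [L.Structure G] (hG : InterpretsAdd f G)
  {M : Type w} [AddCommGroup M] [L.Structure M] (hM : InterpretsAdd f M) (j : G ↪ₑ[L] M)
include hG hM j

/-- An elementary embedding of expansions of groups is a homomorphism. -/
def elementaryEmbeddingAddMonoidHom : G →+ M :=
  AddMonoidHom.mk' j fun x y => by
    rw [← hG, j.map_fun, ← hM]
    congr 1
    ext i
    fin_cases i <;> rfl

theorem comap_range_nsmul {n : ℕ} (hn : 0 < n) :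
    (nsmulAddMonoidHom n : M →+ M).range.comap (elementaryEmbeddingAddMonoidHom hG hM j) =
      (nsmulAddMonoidHom n : G →+ G).range := by
  obtain ⟨n, rfl⟩ := Nat.exists_eq_succ_of_ne_zero hn.ne'
  ext x
  have := j.map_formula (((succNSMulTerm f (Term.var (Sum.inr ())) n).equal
    (Term.var (Sum.inl ())) : L.Formula (Unit ⊕ Unit)).iExs Unit) (fun _ => x)
  simp only [Formula.realize_iExs, Formula.realize_equal, realize_succNSMulTerm hG,
    realize_succNSMulTerm hM, Term.realize_var, Sum.elim_inl, Sum.elim_inr,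
    Function.comp_apply] at this
  simp only [AddSubgroup.mem_comap, AddMonoidHom.mem_range, nsmulAddMonoidHom_apply]
  refine Iff.trans ?_ (this.trans ?_)
  · exact ⟨fun ⟨z, hz⟩ => ⟨fun _ => z, hz⟩, fun ⟨z, hz⟩ => ⟨z (), hz⟩⟩
  · exact ⟨fun ⟨z, hz⟩ => ⟨z (), hz⟩, fun ⟨z, hz⟩ => ⟨fun _ => z, hz⟩⟩

theorem finiteIndex_range_nsmul_iff {n : ℕ} (hn : 0 < n) :
    (nsmulAddMonoidHom n : M →+ M).range.FiniteIndex ↔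
      (nsmulAddMonoidHom n : G →+ G).range.FiniteIndex := by
  constructor
  · intro h
    rw [← comap_range_nsmul hG hM j hn]
    have := AddSubgroup.isFiniteRelIndex_of_finiteIndex (H := (nsmulAddMonoidHom n : M →+ M).range)
      (K := (elementaryEmbeddingAddMonoidHom hG hM j).range)
    exact ⟨by rw [AddSubgroup.index_comap]; exact this.relIndex_ne_zero⟩
  intro h
  obtain ⟨n, rfl⟩ := Nat.exists_eq_succ_of_ne_zero hn.ne'
  let Q := G ⧸ (nsmulAddMonoidHom (n + 1) : G →+ G).range
  have hQ : Finite Q := AddSubgroup.finite_quotient_of_finiteIndex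
  -- This formula says that the cosets of the representatives, one free variable for each `q`, cover
  -- the group.
  let φ : L.Formula Q := Formula.iAlls Unit (Formula.iSup fun q : Q =>
    Formula.iExs Unit ((f.apply₂ (Term.var (Sum.inl (Sum.inl q)))
      (succNSMulTerm f (Term.var (Sum.inr ())) n)).equal (Term.var (Sum.inl (Sum.inr ()))) :
        L.Formula ((Q ⊕ Unit) ⊕ Unit)))
  have key := j.map_formula φ Quotient.out
  simp only [φ, Formula.realize_iAlls, Formula.realize_iSup, Formula.realize_iExs,
    Formula.realize_equal, Term.realize_functions_apply₂, realize_succNSMulTerm hG, hG _ _, hM _ _,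
    realize_succNSMulTerm hM, Term.realize_var, Sum.elim_inl, Sum.elim_inr,
    Function.comp_apply] at key
  have hcov := key.2 fun x => by
    have hx := QuotientAddGroup.eq.1 (QuotientAddGroup.out_eq' (x () : Q))
    obtain ⟨z, hz⟩ := hx
    refine ⟨(x () : Q), fun _ => z, ?_⟩
    rw [nsmulAddMonoidHom_apply] at hz
    rw [hz, add_neg_cancel_left]
  have : Finite (M ⧸ (nsmulAddMonoidHom (n + 1) : M →+ M).range) := by
    refine Finite.of_surjective (fun q : Q => (j q.out : M ⧸ _)) fun q => ?_
    obtain ⟨x, rfl⟩ := QuotientAddGroup.mk_surjective q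
    obtain ⟨q, z, hz⟩ := hcov fun _ => x
    exact ⟨q, QuotientAddGroup.eq.2 ⟨z (), by rw [← hz]; simp⟩⟩
  exact AddSubgroup.finiteIndex_of_finite_quotient

end Elementary

theorem proposition3p9 {L : FirstOrder.Language.{u, v}} (f : L.Functions 2)
    {G : Type w'} [AddCommGroup G] [Infinite G] [L.Structure G] (hG : InterpretsAdd f G)
    {Gs : Type w} [AddCommGroup Gs] [L.Structure Gs] (hGs : InterpretsAdd f Gs)
    (j : G ↪ₑ[L] Gs)
    (κ : Cardinal.{w}) (hκ : ℵ₀ ≤ κ) (hsat : IsSaturatedModel L κ Gs)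
    (A : Set Gs) (hA : #A < κ) :
    ((2 : Cardinal.{max u v w}) ^
        (ℵ₀ + Cardinal.lift.{w} L.card + Cardinal.lift.{max u v} #A) <
          Cardinal.lift.{max u v} κ →
      ∃ H : AddSubgroup Gs, IsTypeConnectedComponent L κ A H) ∧
    ∀ H : AddSubgroup Gs, IsTypeConnectedComponent L κ A H →
      (IsDivisibleGroup H ↔
        ∀ n : ℕ, 0 < n → (nsmulAddMonoidHom n : G →+ G).range.FiniteIndex) := by
  refine ⟨exists_isTypeConnectedComponent hGs hsat hκ hA, fun H hH => ⟨fun hdiv n hn => ?_,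
    fun hfin => ?_⟩⟩
  · exact (finiteIndex_range_nsmul_iff hG hGs j hn).1
      (finiteIndex_range_nsmul_of_isDivisibleGroup hGs hsat hκ hA hH.1.2 hdiv hn)
  · exact isDivisibleGroup_of_finiteIndex hGs hsat hκ hA hH fun n hn =>
      (finiteIndex_range_nsmul_iff hG hGs j hn).2 (hfin n hn)
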